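/- Let $\mathcal A$ be the mod $2$ Steenrod algebra, $\mathcal A^+\subset\mathcal A$ the subspace spanned by the operations of positive degree, and $P_k=\mathbb F_2[x_1,\dots,x_k]$ with each $x_i$ in degree $1$, on which $\mathcal A$ acts by the Cartan formula together with $Sq^0x_i=x_i$, $Sq^1x_i=x_i^2$ and $Sq^jx_i=0$ for $j>1$. Let $GL_k=GL_k(\mathbb F_2)$ act on $P_k$ by linear substitutions of the variables. The space of indecomposables $\mathbb F_2\otimes_{\mathcal A}P_k=P_k/\mathcal A^+P_k$ is then a graded $GL_k$-module; write $(\mathbb F_2\otimes_{\mathcal A}P_k)_d$ for its part of degree $d$. Let $Sq^0_*$ be the endomorphism of $\mathbb F_2\otimes_{\mathcal A}P_k$ (the dual of Kameko's squaring operation) induced by the linear map $P_k\to P_k$ that sends a monomial $x_1^{j_1}\cdots x_k^{j_k}$ to $x_1^{(j_1-1)/2}\cdots x_k^{(j_k-1)/2}$ if all $j_t$ are odd, and to $0$ otherwise; it maps degree $2r+k$ to degree $r$. Then for every integer $s\ge 1$ the iterate $$(Sq^0_*)^s:(\mathbb F_2\otimes_{\mathcal A}P_4)_{12\cdot 2^s-4}\longrightarrow(\mathbb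 F_2\otimes_{\mathcal A}P_4)_8$$ is an isomorphism of $GL_4$-modules. -/

import Mathlib

namespace HitProblem

noncomputable section

open Polynomial

/-! ### The mod 2 Steenrod algebra -/

/-- The defining relations of the mod 2 Steenrod algebra on generators `Sq^0, Sq^1, Sq^2, …`:
`Sq^0 = 1` and the Adem relations. -/
inductive AdemRel : FreeAlgebra (ZMod 2) ℕ → FreeAlgebra (ZMod 2) ℕ → Prop
  | sq_zero : AdemRel (FreeAlgebra.ι (ZMod 2) 0) 1
  | adem (a b : ℕ) (ha : 0 < a) (hab : a < 2 * b) :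
      AdemRel (FreeAlgebra.ι (ZMod 2) a * FreeAlgebra.ι (ZMod 2) b)
        (∑ j ∈ Finset.range (a / 2 + 1), (((b - 1 - j).choose (a - 2 * j) : ℕ) : ZMod 2) •
          (FreeAlgebra.ι (ZMod 2) (a + b - j) * FreeAlgebra.ι (ZMod 2) j))

/-- The mod 2 Steenrod algebra `𝒜`. -/
abbrev SteenrodAlgebra : Type := RingQuot AdemRel

/-- The Steenrod square `Sq^i` as an element of `𝒜`. -/
def steenrodSq (i : ℕ) : SteenrodAlgebra :=
  RingQuot.mkAlgHom (ZMod 2) AdemRel (FreeAlgebra.ι (ZMod 2) i)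

/-- The homogeneous part `𝒜_n`, spanned by the products `Sq^{i₁} ⋯ Sq^{iₘ}` with
`i₁ + ⋯ + iₘ = n`. -/
def steenrodDegree (n : ℕ) : Submodule (ZMod 2) SteenrodAlgebra :=
  Submodule.span (ZMod 2) {θ | ∃ l : List ℕ, l.sum = n ∧ θ = (l.map steenrodSq).prod}

/-- `𝒜⁺`, the sum of the homogeneous parts of positive degree. -/
def steenrodPos : Submodule (ZMod 2) SteenrodAlgebra :=
  ⨆ n : ℕ, steenrodDegree (n + 1)

/-! ### The polynomial algebra `P_k` and the action of `𝒜` on it -/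

/-- `P_k = 𝔽₂[x₁, …, x_k]`. -/
abbrev P (k : ℕ) : Type := MvPolynomial (Fin k) (ZMod 2)

/-- The total square `∑ Tⁱ Sqⁱ : P_k → P_k[T]`, the algebra homomorphism with
`x ↦ x + T x²` on the generators (this is the Cartan formula together with
`Sq^0 x = x`, `Sq^1 x = x²` and `Sq^i x = 0` for `i > 1` in degree one). -/
def totalSq (k : ℕ) : P k →ₐ[ZMod 2] (P k)[X] :=
  MvPolynomial.aeval fun i => C (MvPolynomial.X i) + X * C (MvPolynomial.X i ^ 2)

/-- The operation `Sq^i` on `P_k`. -/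
def sqP (k i : ℕ) : P k →ₗ[ZMod 2] P k :=
  ((Polynomial.lcoeff (P k) i).restrictScalars (ZMod 2)).comp (totalSq k).toLinearMap

theorem sqP_apply (k i : ℕ) (f : P k) : sqP k i f = (totalSq k f).coeff i := rfl

theorem totalSq_X (k : ℕ) (i : Fin k) :
    totalSq k (MvPolynomial.X i) = C (MvPolynomial.X i) + X * C (MvPolynomial.X i ^ 2) := by
  simp [totalSq]

/-- The Cartan formula. -/
theorem sqP_mul (k n : ℕ) (f g : P k) :
    sqP k n (f * g) = ∑ ij ∈ Finset.HasAntidiagonal.antidiagonal n, sqP k ij.1 f * sqP k ij.2 g := by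
  simp only [sqP_apply, map_mul, Polynomial.coeff_mul]

theorem sqP_zero (k : ℕ) : sqP k 0 = 1 := by
  have h : (Polynomial.constantCoeff : (P k)[X] →+* P k).comp (totalSq k).toRingHom
      = RingHom.id _ := by
    apply MvPolynomial.ringHom_ext
    · intro r
      simp [totalSq]
    · intro i
      simp [totalSq]
  refine LinearMap.ext fun f => ?_
  exact DFunLike.congr_fun h f

theorem two_eq_zero {R : Type*} [CommRing R] [Algebra (ZMod 2) R] : (2 : R) = 0 := by
  have h : (algebraMap (ZMod 2) R) 2 = 0 := by
    rw [show (2 : ZMod 2) = 0 from rfl, map_zero]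
  rwa [map_ofNat] at h

/-- The composite of two total squares with parameters `u` (outer) and `t` (inner). -/
def doubleSq (k : ℕ) {R : Type*} [CommRing R] (c : P k →+* R) (u t : R) : P k →+* R :=
  (Polynomial.eval₂RingHom ((Polynomial.eval₂RingHom c u).comp (totalSq k).toRingHom) t).comp
    (totalSq k).toRingHom

theorem doubleSq_congr (k : ℕ) {R : Type*} [CommRing R] (c : P k →+* R) (h2 : (2 : R) = 0)
    (u t v r : R)
    (h : u + t = v + r) (h' : t * u ^ 2 = r * v ^ 2) :
    doubleSq k c u t = doubleSq k c v r := by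
  apply MvPolynomial.ringHom_ext
  · intro a
    have hC : (MvPolynomial.C a : P k) = algebraMap (ZMod 2) (P k) a := rfl
    have h1 : totalSq k (MvPolynomial.C a) = C (MvPolynomial.C a) := by
      rw [hC, AlgHom.commutes]; rfl
    simp [doubleSq, h1]
  · intro i
    have key : ∀ u t : R, doubleSq k c u t (MvPolynomial.X i) =
        c (MvPolynomial.X i) + (u + t) * c (MvPolynomial.X i) ^ 2
          + (t * u ^ 2) * c (MvPolynomial.X i) ^ 4 := by
      intro u t
      simp only [doubleSq, RingHom.comp_apply, AlgHom.toRingHom_eq_coe, RingHom.coe_coe,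
        totalSq_X, map_add, map_mul, map_pow, Polynomial.coe_eval₂RingHom, Polynomial.eval₂_C,
        Polynomial.eval₂_X]
      linear_combination (t * u * c (MvPolynomial.X i) ^ 3) * h2
    rw [key, key, h, h']

theorem doubleSq_eq_sum (k : ℕ) {R : Type*} [CommRing R] (c : P k →+* R) (f : P k) :
    ∃ N₀ : ℕ, ∀ N ≥ N₀, ∀ u t : R, doubleSq k c u t f =
      ∑ b ∈ Finset.range N, ∑ a ∈ Finset.range N,
        c (sqP k a (sqP k b f)) * u ^ a * t ^ b := by
  refine ⟨(totalSq k f).natDegree + 1 + ∑ b ∈ Finset.range ((totalSq k f).natDegree + 1),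
    ((totalSq k (sqP k b f)).natDegree + 1), fun N hN u t => ?_⟩
  have h1 : (totalSq k f).natDegree < N := by omega
  have : doubleSq k c u t f = eval₂ ((Polynomial.eval₂RingHom c u).comp (totalSq k).toRingHom) t
    (totalSq k f) := rfl
  rw [this, Polynomial.eval₂_eq_sum_range' _ h1]
  refine Finset.sum_congr rfl fun b _ => ?_
  rw [← Finset.sum_mul]
  congr 1
  change eval₂ c u (totalSq k (sqP k b f)) = _
  have h2 : (totalSq k (sqP k b f)).natDegree < N := by
    by_cases hb : b < (totalSq k f).natDegree + 1
    · have := Finset.single_le_sum (f := fun b => (totalSq k (sqP k b f)).natDegree + 1)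
        (fun _ _ => Nat.zero_le _) (Finset.mem_range.2 hb)
      have h3 : (totalSq k (sqP k b f)).natDegree + 1 ≤ _ := this
      omega
    · have : sqP k b f = 0 := by
        rw [sqP_apply]; exact Polynomial.coeff_eq_zero_of_natDegree_lt (by omega)
      rw [this, map_zero, Polynomial.natDegree_zero]
      omega
  rw [Polynomial.eval₂_eq_sum_range' _ h2]
  rfl

/-- The Bullett–Macdonald identity, in fixed total degree `n`. -/
theorem bullett_macdonald (k n : ℕ) (f : P k) :
    ∑ ij ∈ Finset.HasAntidiagonal.antidiagonal n,
        C (sqP k ij.1 (sqP k ij.2 f)) * ((X : (P k)[X]) * (1 + X)) ^ ij.1 =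
      ∑ ij ∈ Finset.HasAntidiagonal.antidiagonal n,
        C (sqP k ij.1 (sqP k ij.2 f)) * ((1 + X : (P k)[X]) ^ ij.1 * (X ^ 2) ^ ij.2) := by
  let c : P k →+* (P k)[X][X] := (C : (P k)[X] →+* (P k)[X][X]).comp C
  obtain ⟨N₀, hN₀⟩ := doubleSq_eq_sum (R := (P k)[X][X]) k c f
  have hc := doubleSq_congr (R := (P k)[X][X]) k c two_eq_zero (X * C (X * (1 + X))) (X * C 1) (X * C (1 + X))
    (X * C (X ^ 2)) (by simp only [map_mul, map_add, map_pow, map_one]; ring)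
    (by simp only [map_mul, map_add, map_pow, map_one]; ring)
  have hcoef : ∀ p q : (P k)[X],
      (doubleSq k c (X * C p) (X * C q) f).coeff n =
        ∑ ij ∈ Finset.HasAntidiagonal.antidiagonal n, C (sqP k ij.1 (sqP k ij.2 f)) * p ^ ij.1 * q ^ ij.2 := by
    intro p q
    rw [hN₀ (N₀ + n + 1) (by omega), Finset.sum_comm, ← Finset.sum_product',
      Polynomial.finsetSum_coeff]
    have hterm : ∀ ij : ℕ × ℕ,
        (c (sqP k ij.1 (sqP k ij.2 f)) * (X * C p) ^ ij.1 * (X * C q) ^ ij.2).coeff n =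
        if ij.1 + ij.2 = n then C (sqP k ij.1 (sqP k ij.2 f)) * p ^ ij.1 * q ^ ij.2 else 0 := by
      intro ij
      have : c (sqP k ij.1 (sqP k ij.2 f)) * (X * C p) ^ ij.1 * (X * C q) ^ ij.2 =
          C (C (sqP k ij.1 (sqP k ij.2 f)) * p ^ ij.1 * q ^ ij.2) * X ^ (ij.1 + ij.2) := by
        simp only [c, RingHom.comp_apply, map_mul, map_pow]
        ring
      rw [this, Polynomial.coeff_C_mul_X_pow]
      simp only [eq_comm]
    rw [Finset.sum_congr rfl fun ij _ => hterm ij, ← Finset.sum_filter]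
    refine Finset.sum_congr ?_ fun _ _ => rfl
    ext ⟨i, j⟩
    simp only [Finset.mem_filter, Finset.mem_product, Finset.mem_range, Finset.HasAntidiagonal.mem_antidiagonal]
    omega
  have := congrArg (fun g => (g f).coeff n) hc
  simp only [hcoef, one_pow, mul_one] at this
  simpa only [mul_assoc] using this

/-- The residue functional used to invert the Bullett–Macdonald identity. -/
def residue (k a : ℕ) : (P k)[X] →ₗ[P k] P k :=
  (PowerSeries.coeff a).comp
    ((LinearMap.mulRight (P k) ((PowerSeries.mk 1 : PowerSeries (P k)) ^ (a + 1))).comp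
      (Polynomial.coeToPowerSeries.algHom (P k)).toLinearMap)

theorem residue_apply (k a : ℕ) (g : (P k)[X]) :
    residue k a g = PowerSeries.coeff a
      ((g : PowerSeries (P k)) * (PowerSeries.mk 1 : PowerSeries (P k)) ^ (a + 1)) := by
  simp [residue, Polynomial.coeToPowerSeries.algHom_apply]

theorem one_add_X_mul_mk (k : ℕ) :
    (1 + PowerSeries.X : PowerSeries (P k)) * PowerSeries.mk 1 = 1 := by
  have h := PowerSeries.mk_one_mul_one_sub_eq_one (P k)
  have h2 : (2 : PowerSeries (P k)) = 0 := two_eq_zero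
  linear_combination h + PowerSeries.X * PowerSeries.mk 1 * h2

theorem residue_left (k a c : ℕ) :
    residue k a ((X * (1 + X)) ^ c) = if c = a then 1 else 0 := by
  rw [residue_apply]
  push_cast
  rw [mul_pow]
  rcases lt_trichotomy c a with h | h | h
  · obtain ⟨m, rfl⟩ := Nat.exists_eq_add_of_lt h
    rw [show c + m + 1 + 1 = c + (m + 1 + 1) by ring, pow_add,
      show (PowerSeries.X : PowerSeries (P k)) ^ c * (1 + PowerSeries.X) ^ c *
        ((PowerSeries.mk 1) ^ c * (PowerSeries.mk 1) ^ (m + 1 + 1)) =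
        PowerSeries.X ^ c * ((1 + PowerSeries.X) ^ c * PowerSeries.mk 1 ^ c *
          (PowerSeries.mk 1) ^ (m + 1 + 1)) by ring,
      ← mul_pow, one_add_X_mul_mk, one_pow, one_mul, show c + m + 1 = (m + 1) + c by ring,
      PowerSeries.coeff_X_pow_mul, PowerSeries.mk_one_pow_eq_mk_choose_add,
      PowerSeries.coeff_mk, if_neg (by omega)]
    have h2 : (2 : P k) = 0 := two_eq_zero
    have : (m + 1 + (m + 1)).choose (m + 1) = 2 * (m + 1 + m).choose m := by
      rw [← two_mul, ← Nat.centralBinom_eq_two_mul_choose, Nat.centralBinom]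
      rw [show 2 * (m + 1) = (m + 1 + m) + 1 by ring, Nat.choose_succ_succ,
        Nat.choose_symm_of_eq_add (show m + 1 + m = (m + 1) + m by rfl)]
      ring
    rw [this]
    push_cast
    rw [h2, zero_mul]
  · subst h
    rw [pow_succ (PowerSeries.mk 1 : PowerSeries (P k)),
      show (PowerSeries.X : PowerSeries (P k)) ^ c * (1 + PowerSeries.X) ^ c *
        ((PowerSeries.mk 1) ^ c * (PowerSeries.mk 1)) =
        PowerSeries.X ^ c * ((1 + PowerSeries.X) ^ c * PowerSeries.mk 1 ^ c *
          (PowerSeries.mk 1)) by ring,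
      ← mul_pow, one_add_X_mul_mk, one_pow, one_mul]
    have := PowerSeries.coeff_X_pow_mul (R := P k) (PowerSeries.mk 1) c 0
    rw [zero_add] at this
    rw [this]
    simp
  · rw [mul_assoc, PowerSeries.coeff_X_pow_mul', if_neg (by omega), if_neg (by omega)]

theorem residue_right (k a b j : ℕ) (hab : a < 2 * b) (hj : j ≤ a + b) :
    residue k a ((1 + X) ^ (a + b - j) * (X ^ 2) ^ j) =
      if 2 * j ≤ a then (((b - 1 - j).choose (a - 2 * j) : ℕ) : P k) else 0 := by
  rw [residue_apply]
  push_cast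
  rw [← pow_mul]
  split_ifs with h
  · obtain ⟨e, he⟩ : ∃ e, e = b - 1 - j := ⟨_, rfl⟩
    rw [← he, show a + b - j = (a + 1) + e by omega, pow_add,
      show (1 + PowerSeries.X : PowerSeries (P k)) ^ (a + 1) * (1 + PowerSeries.X) ^ e *
        PowerSeries.X ^ (2 * j) * (PowerSeries.mk 1) ^ (a + 1) =
        PowerSeries.X ^ (2 * j) * ((1 + PowerSeries.X) ^ (a + 1) * PowerSeries.mk 1 ^ (a + 1) *
          (1 + PowerSeries.X) ^ e) by ring,
      ← mul_pow, one_add_X_mul_mk, one_pow, one_mul, PowerSeries.coeff_X_pow_mul', if_pos h]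
    have : ((1 + PowerSeries.X) ^ e : PowerSeries (P k)) = (((1 + X) ^ e : (P k)[X]) :) := by
      push_cast; rfl
    rw [this, Polynomial.coeff_coe, Polynomial.coeff_one_add_X_pow]
  · rw [show (1 + PowerSeries.X : PowerSeries (P k)) ^ (a + b - j) * PowerSeries.X ^ (2 * j) *
        (PowerSeries.mk 1) ^ (a + 1) = PowerSeries.X ^ (2 * j) *
        ((1 + PowerSeries.X) ^ (a + b - j) * (PowerSeries.mk 1) ^ (a + 1)) by ring,
      PowerSeries.coeff_X_pow_mul', if_neg h]

/-- The Adem relations hold on `P_k`. -/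
theorem adem_sqP (k a b : ℕ) (hab : a < 2 * b) :
    sqP k a * sqP k b = ∑ j ∈ Finset.range (a / 2 + 1),
      (((b - 1 - j).choose (a - 2 * j) : ℕ) : ZMod 2) • (sqP k (a + b - j) * sqP k j) := by
  refine LinearMap.ext fun f => ?_
  have h := congrArg (residue k a) (bullett_macdonald k (a + b) f)
  simp only [map_sum, ← Polynomial.smul_eq_C_mul, map_smul, residue_left] at h
  rw [Finset.sum_eq_single (a, b)] at h
  · simp only [if_true, smul_eq_mul, mul_one] at h
    rw [Module.End.mul_apply, h, Finset.Nat.sum_antidiagonal_eq_sum_range_succ_mk,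
      ← Finset.sum_range_reflect, LinearMap.sum_apply]
    have hs : ∀ j ∈ Finset.range (a + b).succ,
        sqP k ((a + b).succ - 1 - j) (sqP k (a + b - ((a + b).succ - 1 - j)) f) *
          residue k a ((1 + X) ^ ((a + b).succ - 1 - j) *
            (X ^ 2) ^ (a + b - ((a + b).succ - 1 - j))) =
        if 2 * j ≤ a then (((b - 1 - j).choose (a - 2 * j) : ℕ) : ZMod 2) •
          (sqP k (a + b - j) (sqP k j f)) else 0 := by
      intro j hj
      have hj' : j ≤ a + b := by simpa [Nat.lt_succ_iff] using hj
      rw [show (a + b).succ - 1 - j = a + b - j by omega,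
        show a + b - (a + b - j) = j by omega, residue_right k a b j hab hj']
      split_ifs
      · rw [Nat.cast_smul_eq_nsmul, nsmul_eq_mul, mul_comm]
      · rw [mul_zero]
    rw [Finset.sum_congr rfl hs, ← Finset.sum_filter]
    refine Finset.sum_congr ?_ fun _ _ => rfl
    ext j
    simp only [Finset.mem_filter, Finset.mem_range]
    omega
  · rintro ⟨i, j⟩ hij hne
    rw [Finset.HasAntidiagonal.mem_antidiagonal] at hij
    simp only at hij ⊢
    rw [if_neg, smul_zero]
    rintro rfl
    exact hne (by rw [show j = b by omega])
  · intro hn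
    exact absurd (by simp) hn

/-- The action of the Steenrod algebra on `P_k`. -/
def steenrodAct (k : ℕ) : SteenrodAlgebra →ₐ[ZMod 2] Module.End (ZMod 2) (P k) :=
  RingQuot.liftAlgHom (ZMod 2) ⟨FreeAlgebra.lift (ZMod 2) (sqP k), by
    intro x y h
    induction h with
    | sq_zero => rw [FreeAlgebra.lift_ι_apply, map_one, sqP_zero]
    | adem a b ha hab =>
      simp only [map_mul, map_sum, map_smul, FreeAlgebra.lift_ι_apply]
      exact adem_sqP k a b hab⟩

theorem steenrodAct_steenrodSq (k i : ℕ) : steenrodAct k (steenrodSq i) = sqP k i := by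
  simp [steenrodAct, steenrodSq]

/-! ### Hit polynomials and the indecomposables `𝔽₂ ⊗_𝒜 P_k` -/

/-- The subspace `𝒜⁺ P_k` of hit (that is, `𝒜`-decomposable) polynomials. -/
def hit (k : ℕ) : Submodule (ZMod 2) (P k) :=
  Submodule.span (ZMod 2) {h | ∃ θ ∈ steenrodPos, ∃ f : P k, h = steenrodAct k θ f}

/-- `𝔽₂ ⊗_𝒜 P_k`, that is, `P_k / 𝒜⁺ P_k`. -/
abbrev Indec (k : ℕ) : Type := P k ⧸ hit k

/-- The homogeneous part `(𝔽₂ ⊗_𝒜 P_k)_d`: the classes of the homogeneous polynomials of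
degree `d`. -/
def indecDegree (k d : ℕ) : Submodule (ZMod 2) (Indec k) :=
  (MvPolynomial.homogeneousSubmodule (Fin k) (ZMod 2) d).map (hit k).mkQ

theorem hit_eq_span (k : ℕ) :
    hit k = Submodule.span (ZMod 2) {h | ∃ i > 0, ∃ f : P k, h = sqP k i f} := by
  apply le_antisymm
  · rw [hit, Submodule.span_le]
    rintro _ ⟨θ, hθ, f, rfl⟩
    have hle : steenrodPos ≤ (Submodule.span (ZMod 2)
        {h | ∃ i > 0, ∃ f : P k, h = sqP k i f}).comap
        ((LinearMap.applyₗ f).comp (steenrodAct k).toLinearMap) := by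
      refine iSup_le fun n => ?_
      rw [steenrodDegree, Submodule.span_le]
      rintro _ ⟨l, hl, rfl⟩
      induction l with
      | nil => simp at hl
      | cons i l ih =>
        rcases Nat.eq_zero_or_pos i with rfl | hi
        · have := ih (by simpa using hl)
          simpa [steenrodAct_steenrodSq, sqP_zero] using this
        · refine Submodule.subset_span ⟨i, hi, steenrodAct k (l.map steenrodSq).prod f, ?_⟩
          simp [steenrodAct_steenrodSq]
    exact hle hθ
  · rw [Submodule.span_le]
    rintro _ ⟨i, hi, f, rfl⟩
    refine Submodule.subset_span ⟨steenrodSq i, ?_, f, by rw [steenrodAct_steenrodSq]⟩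
    refine Submodule.mem_iSup_of_mem (i - 1) (Submodule.subset_span ⟨[i], ?_, by simp⟩)
    simp only [List.sum_singleton]
    omega

/-! ### The action of `GL_k` -/

/-- The linear substitution `x_j ↦ ∑ i, g i j • x_i` of `P_k`. -/
def substP (k : ℕ) (g : Matrix (Fin k) (Fin k) (ZMod 2)) : P k →ₐ[ZMod 2] P k :=
  MvPolynomial.aeval fun j => ∑ i, g i j • MvPolynomial.X i

/-- The action of `GL_k = GL_k(𝔽₂)` on `P_k` by linear substitutions. -/
def glRep (k : ℕ) : Representation (ZMod 2) (GL (Fin k) (ZMod 2)) (P k) where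
  toFun g := (substP k g).toLinearMap
  map_one' := by
    have : substP k (1 : Matrix (Fin k) (Fin k) (ZMod 2)) = AlgHom.id _ _ := by
      ext1 j
      simp [substP, Matrix.one_apply]
    simp [this]
    rfl
  map_mul' g h := by
    have : substP k (g * h : Matrix (Fin k) (Fin k) (ZMod 2)) = (substP k g).comp (substP k h) := by
      ext1 j
      simp only [substP, MvPolynomial.aeval_X, AlgHom.comp_apply, map_sum, map_smul,
        Matrix.mul_apply, Finset.smul_sum, Finset.sum_smul, smul_smul]
      rw [Finset.sum_comm]
      simp only [mul_comm]
    rw [Units.val_mul, this]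
    rfl

theorem substP_sqP (k i : ℕ) (g : Matrix (Fin k) (Fin k) (ZMod 2)) (f : P k) :
    substP k g (sqP k i f) = sqP k i (substP k g f) := by
  have h : (Polynomial.mapAlgHom (substP k g)).comp (totalSq k) =
      (totalSq k).comp (substP k g) := by
    ext1 j
    have hfrob : ∀ s : Finset (Fin k), (∑ i ∈ s, g i j • (MvPolynomial.X i : P k)) ^ 2 =
        ∑ i ∈ s, g i j • (MvPolynomial.X i : P k) ^ 2 := by
      intro s
      rw [sum_pow_char 2]
      refine Finset.sum_congr rfl fun i _ => ?_
      rw [_root_.smul_pow]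
      congr 1
      generalize g i j = z
      revert z
      decide
    have hx : substP k g (MvPolynomial.X j) = ∑ i, g i j • MvPolynomial.X i := by simp [substP]
    rw [AlgHom.comp_apply, AlgHom.comp_apply, totalSq_X, hx, Polynomial.coe_mapAlgHom]
    simp only [Polynomial.map_add, Polynomial.map_mul, Polynomial.map_C, Polynomial.map_X,
      RingHom.coe_coe, hx, map_sum, map_smul, totalSq_X, smul_add,
      Finset.sum_add_distrib]
    rw [map_pow (substP k g), hx, hfrob]
    simp only [map_sum, Finset.mul_sum, ← Polynomial.smul_C, mul_smul_comm, map_pow]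
  have := congrArg (fun F : (P k)[X] => F.coeff i) (DFunLike.congr_fun h f)
  simpa [sqP_apply, Polynomial.coeff_map] using this

theorem hit_le_comap_glRep (k : ℕ) (g : GL (Fin k) (ZMod 2)) :
    hit k ≤ (hit k).comap (glRep k g) := by
  rw [hit_eq_span, Submodule.span_le]
  rintro _ ⟨i, hi, f, rfl⟩
  exact Submodule.subset_span ⟨i, hi, substP k g f, substP_sqP k i g f⟩

/-- The induced action of `GL_k` on `𝔽₂ ⊗_𝒜 P_k`. -/
def indecRep (k : ℕ) : Representation (ZMod 2) (GL (Fin k) (ZMod 2)) (Indec k) :=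
  (glRep k).quotient (hit k) (hit_le_comap_glRep k)

theorem indecDegree_le_comap (k d : ℕ) (g : GL (Fin k) (ZMod 2)) :
    indecDegree k d ≤ (indecDegree k d).comap (indecRep k g) := by
  rintro _ ⟨f, hf, rfl⟩
  refine ⟨substP k g f, ?_, rfl⟩
  have hf' : f.IsHomogeneous d := hf
  have := hf'.aeval (fun j => ∑ i, g.1 i j • (MvPolynomial.X i : P k)) (n := 1) fun j =>
    MvPolynomial.IsHomogeneous.sum _ _ _ fun i _ => by
      rw [MvPolynomial.smul_eq_C_mul]
      exact (MvPolynomial.isHomogeneous_X _ i).C_mul _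
  rw [one_mul] at this
  exact this

/-- The `GL_k`-module `(𝔽₂ ⊗_𝒜 P_k)_d`. -/
def indecDegreeRep (k d : ℕ) :
    Representation (ZMod 2) (GL (Fin k) (ZMod 2)) (indecDegree k d) :=
  (indecRep k).subrepresentation (indecDegree k d) (indecDegree_le_comap k d)

/-! ### The dual of Kameko's squaring operation -/

/-- The linear map `P_k → P_k` sending `x₁^{j₁} ⋯ x_k^{j_k}` to
`x₁^{(j₁-1)/2} ⋯ x_k^{(j_k-1)/2}` if all `j_t` are odd, and to `0` otherwise. -/
def kamekoP (k : ℕ) : P k →ₗ[ZMod 2] P k :=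
  (MvPolynomial.basisMonomials (Fin k) (ZMod 2)).constr (ZMod 2) fun j =>
    if ∀ t, Odd (j t) then
      MvPolynomial.monomial (Finsupp.equivFunOnFinite.symm fun t => (j t - 1) / 2) 1
    else 0

theorem kamekoP_monomial (k : ℕ) (j : Fin k →₀ ℕ) :
    kamekoP k (MvPolynomial.monomial j 1) =
      if ∀ t, Odd (j t) then
        MvPolynomial.monomial (Finsupp.equivFunOnFinite.symm fun t => (j t - 1) / 2) 1
      else 0 := by
  have h := (MvPolynomial.basisMonomials (Fin k) (ZMod 2)).constr_basis (ZMod 2) (fun j =>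
    if ∀ t, Odd (j t) then
      (MvPolynomial.monomial (Finsupp.equivFunOnFinite.symm fun t => (j t - 1) / 2) 1 : P k)
    else 0) j
  rwa [MvPolynomial.coe_basisMonomials] at h

theorem monomial_sq_zmod {k : ℕ} (j : Fin k →₀ ℕ) :
    (MvPolynomial.monomial j 1 : P k) ^ 2 = MvPolynomial.monomial (2 • j) 1 := by
  rw [MvPolynomial.monomial_pow, one_pow]

theorem kamekoP_sq_mul (k : ℕ) (f g : P k) : kamekoP k (f ^ 2 * g) = f * kamekoP k g := by
  induction f using MvPolynomial.induction_on' with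
  | add p q hp hq => rw [add_pow_char, add_mul, map_add, hp, hq, add_mul]
  | monomial i a =>
    have ha : a = 0 ∨ a = 1 := by revert a; decide
    rcases ha with rfl | rfl
    · simp
    rw [monomial_sq_zmod]
    induction g using MvPolynomial.induction_on' with
    | add p q hp hq => rw [mul_add, map_add, hp, hq, map_add, mul_add]
    | monomial j b =>
      have hb : b = 0 ∨ b = 1 := by revert b; decide
      rcases hb with rfl | rfl
      · simp
      rw [MvPolynomial.monomial_mul, one_mul, kamekoP_monomial, kamekoP_monomial]
      have hiff : (∀ t, Odd ((2 • i + j) t)) ↔ ∀ t, Odd (j t) := by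
        refine forall_congr' fun t => ?_
        simp only [Finsupp.add_apply, Finsupp.smul_apply, smul_eq_mul, Nat.odd_iff]
        omega
      simp only [hiff]
      split_ifs with h
      · rw [MvPolynomial.monomial_mul, one_mul]
        congr 2
        ext t
        have := h t
        rw [Nat.odd_iff] at this
        simp only [Finsupp.add_apply, Finsupp.smul_apply, smul_eq_mul,
          Finsupp.equivFunOnFinite_symm_apply_apply]
        omega
      · rw [mul_zero]

theorem sqP_sq (k n : ℕ) (f : P k) :
    sqP k n (f ^ 2) = if 2 ∣ n then sqP k (n / 2) f ^ 2 else 0 := by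
  rw [sqP_apply, map_pow, ← Polynomial.map_frobenius_expand (p := 2), Polynomial.coeff_map,
    Polynomial.coeff_expand (by norm_num)]
  split_ifs
  · rfl
  · simp

theorem kamekoP_sqP_prod (k n : ℕ) (E : Finset (Fin k)) :
    kamekoP k (sqP k n (∏ i ∈ E, MvPolynomial.X i)) =
      if n = 0 ∧ E = Finset.univ then 1 else 0 := by
  classical
  have h1 : totalSq k (∏ i ∈ E, MvPolynomial.X i) = ∑ A ∈ E.powerset,
      C ((MvPolynomial.monomial (∑ i ∈ A, Finsupp.single i 1 +
        ∑ i ∈ E \ A, Finsupp.single i 2) 1 : P k)) * X ^ (E \ A).card := by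
    rw [map_prod]
    simp only [totalSq_X]
    rw [Finset.prod_add]
    refine Finset.sum_congr rfl fun A _ => ?_
    have e1 : (MvPolynomial.monomial (∑ i ∈ A, Finsupp.single i 1 +
        ∑ i ∈ E \ A, Finsupp.single i 2) 1 : P k) =
        (∏ i ∈ A, MvPolynomial.X i) * ∏ i ∈ E \ A, MvPolynomial.X i ^ 2 := by
      rw [← one_mul (1 : ZMod 2), ← MvPolynomial.monomial_mul, MvPolynomial.monomial_sum_one,
        MvPolynomial.monomial_sum_one]
      simp only [MvPolynomial.X_pow_eq_monomial]
      rfl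
    rw [e1, map_mul, map_prod, map_prod, Finset.prod_mul_distrib, Finset.prod_const]
    ring
  have hexp : ∀ A ∈ E.powerset, ∀ t,
      (∑ i ∈ A, Finsupp.single i 1 + ∑ i ∈ E \ A, Finsupp.single i 2 : Fin k →₀ ℕ) t =
        (if t ∈ A then 1 else 0) + if t ∈ E \ A then 2 else 0 := by
    intro A _ t
    simp [Finsupp.single_apply]
  have h2 : ∀ A ∈ E.powerset, kamekoP k ((MvPolynomial.monomial (∑ i ∈ A, Finsupp.single i 1 +
        ∑ i ∈ E \ A, Finsupp.single i 2) 1 : P k)) = if A = Finset.univ then 1 else 0 := by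
    intro A hA
    rw [kamekoP_monomial]
    simp only [hexp A hA]
    by_cases hU : A = Finset.univ
    · subst hU
      simp only [Finset.mem_univ, if_true, Finset.mem_sdiff, not_true, and_false, if_false]
      rw [if_pos (fun _ => by decide)]
      rw [← MvPolynomial.C_1, MvPolynomial.C_apply]
      have h0 : (Finsupp.equivFunOnFinite.symm fun _ => (1 + 0 - 1) / 2 : Fin k →₀ ℕ) = 0 := by
        ext t
        simp
      rw [h0]
    · rw [if_neg hU, if_neg]
      intro hall
      apply hU
      ext t
      simp only [Finset.mem_univ, iff_true]
      by_contra ht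
      have := hall t
      rw [if_neg ht] at this
      split_ifs at this <;> revert this <;> decide
  rw [sqP_apply, h1, Polynomial.finsetSum_coeff, map_sum]
  have h3 : ∀ A ∈ E.powerset, kamekoP k ((C ((MvPolynomial.monomial
      (∑ i ∈ A, Finsupp.single i 1 + ∑ i ∈ E \ A, Finsupp.single i 2) 1 : P k)) *
        X ^ (E \ A).card).coeff n) =
      if A = Finset.univ then (if n = 0 then 1 else 0) else 0 := by
    intro A hA
    rw [Polynomial.coeff_C_mul_X_pow]
    by_cases hU : A = Finset.univ
    · have hc : (E \ A).card = 0 := by subst hU; simp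
      rw [hc, if_pos hU]
      split_ifs
      · rw [h2 A hA, if_pos hU]
      · simp
    · rw [if_neg hU]
      split_ifs
      · rw [h2 A hA, if_neg hU]
      · simp
  rw [Finset.sum_congr rfl h3, Finset.sum_ite_eq']
  by_cases hE : E = Finset.univ
  · subst hE
    simp
  · rw [if_neg (by rwa [Finset.mem_powerset, Finset.univ_subset_iff]), if_neg (by tauto)]

theorem kamekoP_sqP (k n : ℕ) (f : P k) :
    kamekoP k (sqP k n f) = if 2 ∣ n then sqP k (n / 2) (kamekoP k f) else 0 := by
  classical
  induction f using MvPolynomial.induction_on' with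
  | add p q hp hq =>
    rw [map_add, map_add, hp, hq, map_add]
    split_ifs <;> simp
  | monomial j b =>
    have hb : b = 0 ∨ b = 1 := by revert b; decide
    rcases hb with rfl | rfl
    · simp
    obtain ⟨q, E, hq⟩ : ∃ (q : P k) (E : Finset (Fin k)),
        (MvPolynomial.monomial j 1 : P k) = q ^ 2 * ∏ i ∈ E, MvPolynomial.X i := by
      refine ⟨MvPolynomial.monomial (j.mapRange (· / 2) rfl) 1,
        Finset.univ.filter fun t => Odd (j t), ?_⟩
      have e1 : (∏ i ∈ Finset.univ.filter (fun t => Odd (j t)), MvPolynomial.X i : P k) =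
          MvPolynomial.monomial
            (∑ i ∈ Finset.univ.filter (fun t => Odd (j t)), Finsupp.single i 1) 1 := by
        rw [MvPolynomial.monomial_sum_one]
        rfl
      rw [e1, monomial_sq_zmod, MvPolynomial.monomial_mul, one_mul]
      congr 2
      ext t
      simp only [Finsupp.add_apply, Finsupp.smul_apply, Finsupp.mapRange_apply, smul_eq_mul,
        Finsupp.finsetSum_apply, Finsupp.single_apply, Finset.sum_ite_eq', Finset.mem_filter,
        Finset.mem_univ, true_and, Nat.odd_iff]
      split_ifs <;> omega
    rw [hq, sqP_mul, map_sum, kamekoP_sq_mul]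
    have h0 := kamekoP_sqP_prod k 0 E
    rw [sqP_zero, Module.End.one_apply] at h0
    rw [h0]
    have hterm : ∀ ij ∈ Finset.HasAntidiagonal.antidiagonal n,
        kamekoP k (sqP k ij.1 (q ^ 2) * sqP k ij.2 (∏ i ∈ E, MvPolynomial.X i)) =
        if ij = (n, 0) then (if 2 ∣ n ∧ E = Finset.univ then sqP k (n / 2) q else 0) else 0 := by
      rintro ⟨i, l⟩ hil
      rw [Finset.HasAntidiagonal.mem_antidiagonal] at hil
      simp only at hil ⊢
      rw [sqP_sq]
      by_cases h2 : 2 ∣ i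
      · rw [if_pos h2, kamekoP_sq_mul, kamekoP_sqP_prod]
        by_cases hl : l = 0
        · subst hl
          rw [add_zero] at hil
          subst hil
          simp [h2]
        · rw [if_neg (by tauto), if_neg (by simp [hl]), mul_zero]
      · rw [if_neg h2, zero_mul, map_zero]
        split_ifs with h3 h4
        · simp only [Prod.mk.injEq] at h3
          exact absurd (h3.1 ▸ h4.1) h2
        · rfl
        · rfl
    rw [Finset.sum_congr rfl hterm, Finset.sum_ite_eq', if_pos (by simp)]
    by_cases h2 : 2 ∣ n <;> by_cases hE : E = Finset.univ <;> simp [h2, hE]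

theorem hit_le_comap_kamekoP (k : ℕ) : hit k ≤ (hit k).comap (kamekoP k) := by
  rw [hit_eq_span, Submodule.span_le]
  rintro _ ⟨i, hi, f, rfl⟩
  rw [SetLike.mem_coe, Submodule.mem_comap]
  rw [kamekoP_sqP]
  split_ifs with h
  · exact Submodule.subset_span ⟨i / 2, Nat.div_pos (Nat.le_of_dvd hi h) two_pos, _, rfl⟩
  · exact Submodule.zero_mem _

/-- The dual Kameko squaring operation `Sq^0_*` on `𝔽₂ ⊗_𝒜 P_k`. -/
def kamekoSq (k : ℕ) : Indec k →ₗ[ZMod 2] Indec k :=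
  (hit k).mapQ (hit k) (kamekoP k) (hit_le_comap_kamekoP k)

end

end HitProblem

namespace HitProblem

noncomputable section

open Polynomial

/-! ### Generalities on monomials and degrees -/

/-! The degrees `d_s = 12 * 2 ^ s - 4` satisfy `d_0 = 8` and `d_{s+1} = 2 * d_s + 4`, so it suffices
that one application of `Sq^0_*` is bijective from degree `d_{s+1}` to degree `d_s`. This is
Kameko's theorem (`kamekoSq_bijOn`), which applies when the source degree is not a sum of fewer than
`k` numbers `2^a - 1`; for `k = 4` and `d_{s+1}` this is arithmetic modulo 8 plus a size check
(`notShortSum_four`).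

Surjectivity comes from the section `f ↦ x₁⋯x_k f²`. For injectivity, let `kamekoP k f` be hit.
Since `kamekoP` carries `Sq^{2i}` to `Sq^i`, this image lifts to a hit polynomial
(`exists_hit_lift`). Subtracting the lift leaves an element of the kernel, a sum of monomials with
some even exponent. Such a monomial is `u q²`, with `u` a product of fewer than `k` distinct
variables and `q² = Sq^n q` for `n = deg q`. Modulo hit polynomials `u Sq^n q` equals `χ(Sq^n)(u) q`
(`mul_sqP_sub_coeff_mul_mem_hit`). The conjugate total square of a variable involves only the powers
`T^(2^a - 1)`, so `χ(Sq^n)(u) = 0` unless the degree is a short sum (`monomial_mem_hit`).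

Equivariance already holds on `P_k` (`kamekoP_substP`): `kamekoP` pulls squares out, which reduces
the claim to `x₁⋯x_k`, where the scalar that appears is a nonzero element of `𝔽₂`. -/

theorem finsupp_induction_single_one {ι : Type*} {M : (ι →₀ ℕ) → Prop} (h0 : M 0)
    (h1 : ∀ i, M (Finsupp.single i 1)) (hadd : ∀ f g, M f → M g → M (f + g)) (j : ι →₀ ℕ) :
    M j := by
  induction j using Finsupp.induction_linear with
  | zero => exact h0
  | add f g hf hg => exact hadd f g hf hg
  | single i n =>
    induction n with
    | zero => simpa using h0
    | succ n ih => rw [Finsupp.single_add]; exact hadd _ _ ih (h1 i)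

theorem monomial_add_one {k : ℕ} (i j : Fin k →₀ ℕ) :
    (MvPolynomial.monomial (i + j) 1 : P k) =
      MvPolynomial.monomial i 1 * MvPolynomial.monomial j 1 := by
  rw [MvPolynomial.monomial_mul, one_mul]

/-- The two claims are proved together because the top coefficient of a product is the product of
the top coefficients only when the degree bounds are known. -/
theorem totalSq_monomial_natDegree_coeff (k : ℕ) (j : Fin k →₀ ℕ) :
    (totalSq k (MvPolynomial.monomial j 1)).natDegree ≤ j.degree ∧
      (totalSq k (MvPolynomial.monomial j 1)).coeff j.degree =
        (MvPolynomial.monomial j 1) ^ 2 := by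
  induction j using finsupp_induction_single_one with
  | h0 =>
    have : (MvPolynomial.monomial 0 1 : P k) = 1 := rfl
    simp [this]
  | h1 i =>
    have : (MvPolynomial.monomial (Finsupp.single i 1) 1 : P k) = MvPolynomial.X i := rfl
    rw [this, totalSq_X, Finsupp.degree_single]
    constructor
    · compute_degree
    · simp [-map_pow]
  | hadd f g hf hg =>
    rw [monomial_add_one, map_mul, map_add, mul_pow]
    refine ⟨Polynomial.natDegree_mul_le.trans (add_le_add hf.1 hg.1), ?_⟩
    rw [Polynomial.coeff_mul_add_eq_of_natDegree_le hf.1 hg.1, hf.2, hg.2]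

/-- The top square of a monomial is its square. -/
theorem sqP_degree_monomial (k : ℕ) (j : Fin k →₀ ℕ) :
    sqP k j.degree (MvPolynomial.monomial j 1) = (MvPolynomial.monomial j 1) ^ 2 :=
  (totalSq_monomial_natDegree_coeff k j).2

theorem sqP_X_isHomogeneous (k i : ℕ) (t : Fin k) :
    (sqP k i (MvPolynomial.X t)).IsHomogeneous (1 + i) := by
  rw [sqP_apply, totalSq_X]
  rcases i with _ | _ | i
  · simpa using MvPolynomial.isHomogeneous_X _ t
  · simpa [← map_pow] using MvPolynomial.isHomogeneous_X_pow (R := ZMod 2) t 2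
  · simpa [← map_pow, Polynomial.coeff_C] using
      MvPolynomial.isHomogeneous_zero (Fin k) (ZMod 2) (1 + (i + 1 + 1))

theorem sqP_monomial_isHomogeneous (k : ℕ) (j : Fin k →₀ ℕ) :
    ∀ i, (sqP k i (MvPolynomial.monomial j 1)).IsHomogeneous (j.degree + i) := by
  induction j using finsupp_induction_single_one with
  | h0 =>
    intro i
    have : (MvPolynomial.monomial 0 1 : P k) = 1 := rfl
    rw [this, sqP_apply, map_one, Polynomial.coeff_one]
    split_ifs with h
    · subst h
      simpa using MvPolynomial.isHomogeneous_one (Fin k) (ZMod 2)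
    · exact MvPolynomial.isHomogeneous_zero _ _ _
  | h1 t =>
    intro i
    rw [Finsupp.degree_single]
    exact sqP_X_isHomogeneous k i t
  | hadd f g hf hg =>
    intro i
    rw [monomial_add_one, sqP_mul]
    refine MvPolynomial.IsHomogeneous.sum _ _ _ fun ab hab => ?_
    rw [Finset.HasAntidiagonal.mem_antidiagonal] at hab
    have := (hf ab.1).mul (hg ab.2)
    rwa [show f.degree + ab.1 + (g.degree + ab.2) = (f + g).degree + i by
      rw [map_add]; omega] at this

theorem zmod_two_eq_one {a : ZMod 2} (h : a ≠ 0) : a = 1 := by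
  revert a; decide

theorem eq_sum_monomial {k : ℕ} (f : P k) :
    f = ∑ j ∈ f.support, MvPolynomial.monomial j 1 := by
  conv_lhs => rw [f.as_sum]
  refine Finset.sum_congr rfl fun j hj => ?_
  rw [zmod_two_eq_one (MvPolynomial.mem_support_iff.1 hj)]

theorem degree_eq_of_mem_support {k n : ℕ} {f : P k} (hf : f.IsHomogeneous n)
    {j : Fin k →₀ ℕ} (hj : j ∈ f.support) : j.degree = n := by
  rw [Finsupp.degree_eq_weight_one]
  exact hf (MvPolynomial.mem_support_iff.1 hj)

theorem sqP_isHomogeneous {k n : ℕ} {f : P k} (hf : f.IsHomogeneous n) (i : ℕ) :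
    (sqP k i f).IsHomogeneous (n + i) := by
  rw [eq_sum_monomial f, map_sum]
  refine MvPolynomial.IsHomogeneous.sum _ _ _ fun j hj => ?_
  rw [← degree_eq_of_mem_support hf hj]
  exact sqP_monomial_isHomogeneous k j i

theorem sqP_mem_hit {k i : ℕ} (hi : 0 < i) (f : P k) : sqP k i f ∈ hit k := by
  rw [hit_eq_span]
  exact Submodule.subset_span ⟨i, hi, f, rfl⟩

/-- The hit polynomials of degree `r` are spanned by the `Sq^i f` with `f` homogeneous. -/
theorem homogeneousComponent_mem_span {k : ℕ} (r : ℕ) {h : P k} (hh : h ∈ hit k) :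
    MvPolynomial.homogeneousComponent r h ∈ Submodule.span (ZMod 2)
      {h | ∃ i > 0, ∃ m, m + i = r ∧ ∃ f : P k, f.IsHomogeneous m ∧ h = sqP k i f} := by
  rw [hit_eq_span] at hh
  induction hh using Submodule.span_induction with
  | zero => rw [map_zero]; exact Submodule.zero_mem _
  | add x y _ _ hx hy => rw [map_add]; exact Submodule.add_mem _ hx hy
  | smul a x _ hx => rw [map_smul]; exact Submodule.smul_mem _ _ hx
  | mem x hx =>
    obtain ⟨i, hi, f, rfl⟩ := hx
    rw [← MvPolynomial.sum_homogeneousComponent f, map_sum, map_sum]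
    refine Submodule.sum_mem _ fun m _ => ?_
    have hm := MvPolynomial.homogeneousComponent_isHomogeneous m f
    rw [MvPolynomial.homogeneousComponent_of_mem (sqP_isHomogeneous hm i)]
    split_ifs with hr
    · exact Submodule.subset_span ⟨i, hi, m, hr.symm, _, hm, rfl⟩
    · exact Submodule.zero_mem _

/-! ### The conjugation trick -/

/-- The total square, extended `T`-linearly to `P_k[T]`. -/
def totalSqExt (k : ℕ) : (P k)[X] →+* (P k)[X] :=
  Polynomial.eval₂RingHom (totalSq k).toRingHom X

theorem totalSqExt_C (k : ℕ) (f : P k) : totalSqExt k (C f) = totalSq k f := by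
  simp [totalSqExt]

theorem totalSqExt_X (k : ℕ) : totalSqExt k X = X := by
  simp [totalSqExt]

/-- For `W = ∑ w_j T^j` the coefficient of the image is `∑ Sq^{n-j} w_j` over `j ≤ n`; every term is
hit except `j = n`, which is `w_n`. -/
theorem coeff_totalSqExt_sub_mem_hit (k n : ℕ) (W : (P k)[X]) :
    (totalSqExt k W).coeff n - W.coeff n ∈ hit k := by
  induction W using Polynomial.induction_on' with
  | add p q hp hq =>
    rw [map_add, Polynomial.coeff_add, Polynomial.coeff_add, add_sub_add_comm]
    exact Submodule.add_mem _ hp hq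
  | monomial j w =>
    rw [← Polynomial.C_mul_X_pow_eq_monomial, map_mul, map_pow, totalSqExt_C, totalSqExt_X,
      Polynomial.coeff_mul_X_pow', Polynomial.coeff_C_mul_X_pow]
    rcases lt_trichotomy j n with h | rfl | h
    · rw [if_pos h.le, if_neg h.ne', sub_zero]
      exact sqP_mem_hit (Nat.sub_pos_of_lt h) w
    · rw [if_pos le_rfl, if_pos rfl, Nat.sub_self, ← sqP_apply, sqP_zero, Module.End.one_apply,
        sub_self]
      exact Submodule.zero_mem _
    · rw [if_neg h.not_ge, if_neg h.ne, sub_self]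
      exact Submodule.zero_mem _

/-- If `U` inverts the total square on `u` up to order `n`, then `Sq^n` can be moved from one
factor of a product to the other, modulo hit polynomials. -/
theorem mul_sqP_sub_coeff_mul_mem_hit {k n : ℕ} {u : P k} {U : (P k)[X]}
    (hU : X ^ (n + 1) ∣ totalSqExt k U - C u) (v : P k) :
    u * sqP k n v - U.coeff n * v ∈ hit k := by
  -- Up to order `n`, the extended total square sends `U v` to `u` times the total square of `v`,
  -- with `n`-th coefficient `u Sq^n v`.
  have h := coeff_totalSqExt_sub_mem_hit k n (U * C v)
  rw [map_mul, totalSqExt_C, Polynomial.coeff_mul_C] at h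
  obtain ⟨R, hR⟩ := hU
  have h1 : (totalSqExt k U * totalSq k v).coeff n = u * sqP k n v := by
    rw [sub_eq_iff_eq_add.1 hR, add_mul, mul_assoc, Polynomial.coeff_add,
      Polynomial.coeff_X_pow_mul', if_neg (by omega), zero_add, Polynomial.coeff_C_mul, sqP_apply]
  rwa [h1] at h

/-- The conjugate total square `x + T x² + T³ x⁴ + ⋯` of a variable, cut off after `N` terms. -/
def conjSqX (k N : ℕ) (i : Fin k) : (P k)[X] :=
  ∑ a ∈ Finset.range N, C (MvPolynomial.X i ^ 2 ^ a) * X ^ (2 ^ a - 1)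

/-- The sum telescopes modulo 2: the term `x^(2^a) T^(2^a - 1)` is sent to itself plus the next
term, so only `x` and the term of index `N` survive. For `N = 0` the right side is `x + x = 0`. -/
theorem totalSqExt_conjSqX (k N : ℕ) (i : Fin k) :
    totalSqExt k (conjSqX k N i) =
      C (MvPolynomial.X i) + C (MvPolynomial.X i ^ 2 ^ N) * X ^ (2 ^ N - 1) := by
  induction N with
  | zero =>
    have h2 : (2 : (P k)[X]) = 0 := two_eq_zero
    simp only [conjSqX, Finset.range_zero, Finset.sum_empty, map_zero, pow_zero, pow_one,
      Nat.sub_self, mul_one]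
    linear_combination -C (MvPolynomial.X i) * h2
  | succ N ih =>
    have h2 : (2 : (P k)[X]) = 0 := two_eq_zero
    rw [conjSqX] at ih ⊢
    rw [Finset.sum_range_succ, map_add, ih, map_mul, totalSqExt_C, map_pow (totalSq k),
      map_pow (totalSqExt k), totalSqExt_X,
      totalSq_X, add_pow_char_pow, add_mul, mul_pow, ← map_pow, ← map_pow, ← pow_mul, ← pow_succ']
    have e : (X : (P k)[X]) ^ (2 ^ (N + 1) - 1) = X ^ 2 ^ N * X ^ (2 ^ N - 1) := by
      rw [← pow_add]
      congr 1
      have := Nat.one_le_two_pow (n := N)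
      rw [pow_succ]
      omega
    rw [e]
    linear_combination C (MvPolynomial.X i ^ 2 ^ N) * X ^ (2 ^ N - 1) * h2

theorem X_pow_dvd_totalSqExt_prod_conjSqX (k n : ℕ) (E : Finset (Fin k)) :
    X ^ (n + 1) ∣ totalSqExt k (∏ i ∈ E, conjSqX k (n + 1) i) - C (∏ i ∈ E, MvPolynomial.X i) := by
  have hle : n + 1 ≤ 2 ^ (n + 1) - 1 := by
    have := Nat.lt_two_pow_self (n := n + 1)
    omega
  -- In the quotient by `T^(n+1)` the congruence can be checked factor by factor; there the error
  -- term, of order `2^(n+1) - 1 ≥ n + 1`, vanishes.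
  rw [← Ideal.mem_span_singleton, ← Ideal.Quotient.eq, map_prod, map_prod, map_prod, map_prod]
  refine Finset.prod_congr rfl fun i _ => ?_
  rw [totalSqExt_conjSqX, Ideal.Quotient.eq, Ideal.mem_span_singleton, add_sub_cancel_left]
  exact (pow_dvd_pow _ hle).mul_left _

/-- Each factor contributes a power `T^(2^a - 1)`, so any `T^n` occurring in the product has such
exponents adding up to `n`. The values of `a` off `E` play no role. -/
theorem exists_of_coeff_prod_conjSqX_ne_zero {k N : ℕ} {E : Finset (Fin k)} :
    ∀ {n : ℕ}, (∏ i ∈ E, conjSqX k N i).coeff n ≠ 0 →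
      ∃ a : Fin k → ℕ, ∑ i ∈ E, (2 ^ a i - 1) = n := by
  classical
  induction E using Finset.induction_on with
  | empty =>
    intro n h
    rw [Finset.prod_empty, Polynomial.coeff_one] at h
    exact ⟨0, by simpa [eq_comm] using h⟩
  | insert t E ht ih =>
    intro n h
    rw [Finset.prod_insert ht, Polynomial.coeff_mul] at h
    obtain ⟨⟨p, q⟩, hpq, h⟩ := Finset.exists_ne_zero_of_sum_ne_zero h
    rw [Finset.HasAntidiagonal.mem_antidiagonal] at hpq
    obtain ⟨a, ha⟩ := ih (right_ne_zero_of_mul h)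
    have hp := left_ne_zero_of_mul h
    rw [conjSqX, Polynomial.finsetSum_coeff] at hp
    obtain ⟨b, -, hb⟩ := Finset.exists_ne_zero_of_sum_ne_zero hp
    rw [Polynomial.coeff_C_mul_X_pow] at hb
    have hb' : p = 2 ^ b - 1 := by
      by_contra hne
      exact hb (if_neg hne)
    refine ⟨Function.update a t b, ?_⟩
    rw [Finset.sum_insert ht, Function.update_self, ← hb', ← hpq, ← ha]
    congr 1
    refine Finset.sum_congr rfl fun i hi => ?_
    rw [Function.update_of_ne (ne_of_mem_of_not_mem hi ht)]

/-- A product of distinct variables, indexed by `E`, times the square of a monomial of degree `n`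
is hit if `n` is not a sum of `|E|` numbers of the form `2^a - 1`. -/
theorem prod_X_mul_monomial_sq_mem_hit {k : ℕ} (E : Finset (Fin k)) (q : Fin k →₀ ℕ)
    (h : ∀ a : Fin k → ℕ, ∑ i ∈ E, (2 ^ a i - 1) ≠ q.degree) :
    (∏ i ∈ E, MvPolynomial.X i) * (MvPolynomial.monomial q 1 : P k) ^ 2 ∈ hit k := by
  -- The square of the monomial is its top Steenrod square, and that operation is moved onto the
  -- product of variables.
  have h1 := mul_sqP_sub_coeff_mul_mem_hit (X_pow_dvd_totalSqExt_prod_conjSqX k q.degree E)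
    (MvPolynomial.monomial q 1)
  have h2 : (∏ i ∈ E, conjSqX k (q.degree + 1) i).coeff q.degree = 0 := by
    by_contra hne
    obtain ⟨a, ha⟩ := exists_of_coeff_prod_conjSqX_ne_zero hne
    exact h a ha
  rwa [h2, zero_mul, sub_zero, sqP_degree_monomial] at h1

/-! ### Kameko's isomorphism -/

/-- `d` is not a sum of fewer than `k` numbers of the form `2^a - 1`. -/
def NotShortSum (k d : ℕ) : Prop :=
  ∀ a : Fin k → ℕ, (∃ i, a i = 0) → ∑ i, (2 ^ a i - 1) ≠ d

theorem exists_monomial_eq_prod_X_mul_sq {k : ℕ} (j : Fin k →₀ ℕ) :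
    ∃ (E : Finset (Fin k)) (q : Fin k →₀ ℕ), (∀ t, t ∈ E ↔ Odd (j t)) ∧
      j.degree = E.card + 2 * q.degree ∧
      (MvPolynomial.monomial j 1 : P k) =
        (∏ i ∈ E, MvPolynomial.X i) * (MvPolynomial.monomial q 1) ^ 2 := by
  classical
  let E : Finset (Fin k) := Finset.univ.filter fun t => Odd (j t)
  let q : Fin k →₀ ℕ := j.mapRange (· / 2) rfl
  have hj : j = ∑ i ∈ E, Finsupp.single i 1 + 2 • q := by
    ext t
    simp only [E, q, Finsupp.add_apply, Finsupp.smul_apply, Finsupp.mapRange_apply, smul_eq_mul,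
      Finsupp.finsetSum_apply, Finsupp.single_apply, Finset.sum_ite_eq', Finset.mem_filter,
      Finset.mem_univ, true_and, Nat.odd_iff]
    split_ifs <;> omega
  refine ⟨E, q, fun t => by simp [E], ?_, ?_⟩
  · conv_lhs => rw [hj]
    simp
  · conv_lhs => rw [hj]
    rw [monomial_add_one, monomial_sq_zmod, MvPolynomial.monomial_sum_one]
    rfl

/-- Write the monomial as a product over `E` times `q²`, so that `d = |E| + 2 deg q`. If `deg q =
∑_E (2^a - 1)`, then `d = ∑_E (2^(a+1) - 1)`, with `|E| < k` because some exponent is even. -/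
theorem monomial_mem_hit {k d : ℕ} (hd : NotShortSum k d) {j : Fin k →₀ ℕ} (hj : j.degree = d)
    (hodd : ¬ ∀ t, Odd (j t)) : (MvPolynomial.monomial j 1 : P k) ∈ hit k := by
  classical
  obtain ⟨E, q, hE, hdeg, heq⟩ := exists_monomial_eq_prod_X_mul_sq j
  rw [heq]
  refine prod_X_mul_monomial_sq_mem_hit E q fun a ha => ?_
  push Not at hodd
  obtain ⟨t, ht⟩ := hodd
  have htE : t ∉ E := fun h => absurd ((hE t).1 h) (by simpa using ht)
  -- Exponent 0 off `E` contributes `2^0 - 1 = 0`, and `t ∉ E` provides the zero exponent that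
  -- `NotShortSum` asks for.
  refine hd (fun i => if i ∈ E then a i + 1 else 0) ⟨t, if_neg htE⟩ ?_
  rw [← hj, hdeg, ← ha, Finset.mul_sum, Finset.card_eq_sum_ones, ← Finset.sum_add_distrib,
    ← Finset.sum_subset (Finset.subset_univ E)]
  · refine Finset.sum_congr rfl fun i hi => ?_
    have := Nat.one_le_two_pow (n := a i)
    rw [if_pos hi, pow_succ]
    omega
  · intro i _ hi
    rw [if_neg hi, pow_zero, Nat.sub_self]

theorem equivFunOnFinite_half_injOn {k : ℕ} {i j : Fin k →₀ ℕ} (hi : ∀ t, Odd (i t))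
    (hj : ∀ t, Odd (j t))
    (h : (Finsupp.equivFunOnFinite.symm fun t => (i t - 1) / 2 : Fin k →₀ ℕ) =
      Finsupp.equivFunOnFinite.symm fun t => (j t - 1) / 2) : i = j := by
  ext t
  have := DFunLike.congr_fun h t
  simp only [Finsupp.equivFunOnFinite_symm_apply_apply] at this
  have h1 := hi t
  have h2 := hj t
  rw [Nat.odd_iff] at h1 h2
  omega

theorem coeff_kamekoP (k : ℕ) (f : P k) {j : Fin k →₀ ℕ} (hj : ∀ t, Odd (j t)) :
    MvPolynomial.coeff (Finsupp.equivFunOnFinite.symm fun t => (j t - 1) / 2) (kamekoP k f) =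
      MvPolynomial.coeff j f := by
  induction f using MvPolynomial.induction_on' with
  | add p q hp hq => rw [map_add, MvPolynomial.coeff_add, hp, hq, MvPolynomial.coeff_add]
  | monomial i a =>
    by_cases ha : a = 0
    · simp [ha]
    rw [zmod_two_eq_one ha, kamekoP_monomial, MvPolynomial.coeff_monomial]
    split_ifs with h1 h2 h2
    · subst h2
      rw [MvPolynomial.coeff_monomial, if_pos rfl]
    · rw [MvPolynomial.coeff_monomial, if_neg fun h => h2 (equivFunOnFinite_half_injOn h1 hj h)]
    · exact absurd (h2 ▸ hj) h1
    · exact MvPolynomial.coeff_zero _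

/-- Distinct all-odd monomials have distinct images, so nothing cancels: a polynomial in the kernel
contains no all-odd monomial. -/
theorem mem_hit_of_kamekoP_eq_zero {k d : ℕ} (hd : NotShortSum k d) {f : P k}
    (hf : f.IsHomogeneous d) (h : kamekoP k f = 0) : f ∈ hit k := by
  rw [eq_sum_monomial f]
  refine Submodule.sum_mem _ fun j hj => ?_
  refine monomial_mem_hit hd (degree_eq_of_mem_support hf hj) fun hodd => ?_
  rw [MvPolynomial.mem_support_iff, ← coeff_kamekoP k f hodd, h] at hj
  exact hj (MvPolynomial.coeff_zero _)

theorem kamekoP_isHomogeneous {k r : ℕ} {f : P k} (hf : f.IsHomogeneous (2 * r + k)) :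
    (kamekoP k f).IsHomogeneous r := by
  rw [eq_sum_monomial f, map_sum]
  refine MvPolynomial.IsHomogeneous.sum _ _ _ fun j hj => ?_
  have hdeg := degree_eq_of_mem_support hf hj
  rw [kamekoP_monomial]
  split_ifs with h
  · refine MvPolynomial.isHomogeneous_monomial _ ?_
    have e : ∑ t, j t = ∑ t, (2 * ((j t - 1) / 2) + 1) :=
      Finset.sum_congr rfl fun t _ => by
        have := h t
        rw [Nat.odd_iff] at this
        omega
    rw [Finset.sum_add_distrib, ← Finset.mul_sum] at e
    simp only [Finset.sum_const, Finset.card_univ, Fintype.card_fin, smul_eq_mul, mul_one] at e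
    rw [Finsupp.degree_eq_sum] at hdeg ⊢
    simp only [Finsupp.equivFunOnFinite_symm_apply_apply]
    omega
  · exact MvPolynomial.isHomogeneous_zero _ _ _

/-- Kameko's section `f ↦ x₁ ⋯ x_k f²` of `kamekoP`. -/
def kamekoUp (k : ℕ) (f : P k) : P k :=
  f ^ 2 * ∏ i, MvPolynomial.X i

theorem kamekoP_prod_X (k : ℕ) (E : Finset (Fin k)) :
    kamekoP k (∏ i ∈ E, MvPolynomial.X i) = if E = Finset.univ then 1 else 0 := by
  simpa [sqP_zero] using kamekoP_sqP_prod k 0 E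

theorem kamekoP_kamekoUp (k : ℕ) (f : P k) : kamekoP k (kamekoUp k f) = f := by
  rw [kamekoUp, kamekoP_sq_mul, kamekoP_prod_X, if_pos rfl, mul_one]

theorem prod_X_isHomogeneous {k : ℕ} (E : Finset (Fin k)) :
    (∏ i ∈ E, MvPolynomial.X i : P k).IsHomogeneous E.card := by
  rw [Finset.card_eq_sum_ones]
  exact MvPolynomial.IsHomogeneous.prod _ _ _ fun i _ => MvPolynomial.isHomogeneous_X _ i

theorem kamekoUp_isHomogeneous {k r : ℕ} {f : P k} (hf : f.IsHomogeneous r) :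
    (kamekoUp k f).IsHomogeneous (2 * r + k) := by
  have := (hf.pow 2).mul (prod_X_isHomogeneous (Finset.univ : Finset (Fin k)))
  rwa [Finset.card_univ, Fintype.card_fin, mul_comm r 2] at this

/-- Every hit polynomial of degree `r` is the image under `kamekoP` of a hit polynomial of degree
`2r + k`. -/
theorem exists_hit_lift {k r : ℕ} {h : P k} (hr : h.IsHomogeneous r) (hh : h ∈ hit k) :
    ∃ W ∈ hit k, W.IsHomogeneous (2 * r + k) ∧ kamekoP k W = h := by
  -- Generators `Sq^i f` with `f` homogeneous are needed for the lift to be homogeneous.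
  have key := homogeneousComponent_mem_span r hh
  rw [MvPolynomial.homogeneousComponent_of_mem hr, if_pos rfl] at key
  clear hr hh
  induction key using Submodule.span_induction with
  | zero => exact ⟨0, Submodule.zero_mem _, MvPolynomial.isHomogeneous_zero _ _ _, map_zero _⟩
  | add x y _ _ hx hy =>
    obtain ⟨V, hV, hV', rfl⟩ := hx
    obtain ⟨W, hW, hW', rfl⟩ := hy
    exact ⟨V + W, Submodule.add_mem _ hV hW, hV'.add hW', map_add _ _ _⟩
  | smul a x _ hx =>
    obtain ⟨V, hV, hV', rfl⟩ := hx
    exact ⟨a • V, Submodule.smul_mem _ _ hV,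
      Submodule.smul_mem (MvPolynomial.homogeneousSubmodule _ _ _) _ hV', map_smul _ _ _⟩
  | mem x hx =>
    obtain ⟨i, hi, m, rfl, f, hf, rfl⟩ := hx
    -- Halving the operation: `kamekoP` turns `Sq^{2i}` of the section at `f` into `Sq^i f`.
    refine ⟨sqP k (2 * i) (kamekoUp k f), sqP_mem_hit (by omega) _, ?_, ?_⟩
    · have := sqP_isHomogeneous (kamekoUp_isHomogeneous hf) (2 * i)
      rwa [show 2 * m + k + 2 * i = 2 * (m + i) + k by ring] at this
    · rw [kamekoP_sqP, if_pos (dvd_mul_right _ _), Nat.mul_div_cancel_left _ two_pos,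
        kamekoP_kamekoUp]

theorem mem_hit_of_kamekoP_mem_hit {k r : ℕ} (hd : NotShortSum k (2 * r + k)) {f : P k}
    (hf : f.IsHomogeneous (2 * r + k)) (h : kamekoP k f ∈ hit k) : f ∈ hit k := by
  obtain ⟨W, hW, hW', e⟩ := exists_hit_lift (kamekoP_isHomogeneous hf) h
  have := mem_hit_of_kamekoP_eq_zero hd (hf.sub hW') (by rw [map_sub, e, sub_self])
  simpa using Submodule.add_mem _ this hW

theorem kamekoSq_mk (k : ℕ) (f : P k) :
    kamekoSq k ((hit k).mkQ f) = (hit k).mkQ (kamekoP k f) := rfl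

/-- Kameko's theorem: if `2r + k` is not a sum of fewer than `k` numbers `2^a - 1`, then
`Sq^0_*` maps the part of degree `2r + k` bijectively onto the part of degree `r`. -/
theorem kamekoSq_bijOn {k r : ℕ} (hd : NotShortSum k (2 * r + k)) :
    Set.BijOn (kamekoSq k) (indecDegree k (2 * r + k)) (indecDegree k r) := by
  refine ⟨?_, ?_, ?_⟩
  · rintro _ ⟨f, hf, rfl⟩
    exact ⟨kamekoP k f, kamekoP_isHomogeneous hf, rfl⟩
  · rintro _ ⟨f, hf, rfl⟩ _ ⟨g, hg, rfl⟩ h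
    have hf' : f.IsHomogeneous (2 * r + k) := hf
    have hg' : g.IsHomogeneous (2 * r + k) := hg
    rw [kamekoSq_mk, kamekoSq_mk, ← sub_eq_zero, ← map_sub, ← map_sub, Submodule.mkQ_apply,
      Submodule.Quotient.mk_eq_zero] at h
    rw [← sub_eq_zero, ← map_sub, Submodule.mkQ_apply, Submodule.Quotient.mk_eq_zero]
    exact mem_hit_of_kamekoP_mem_hit hd (hf'.sub hg') h
  · rintro _ ⟨f, hf, rfl⟩
    exact ⟨_, ⟨kamekoUp k f, kamekoUp_isHomogeneous hf, rfl⟩,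
      by rw [kamekoSq_mk, kamekoP_kamekoUp]⟩

/-! ### Equivariance -/

theorem substP_isHomogeneous {k n : ℕ} (g : Matrix (Fin k) (Fin k) (ZMod 2)) {f : P k}
    (hf : f.IsHomogeneous n) : (substP k g f).IsHomogeneous n := by
  have := hf.aeval (fun j => ∑ i, g i j • (MvPolynomial.X i : P k)) (n := 1) fun j =>
    MvPolynomial.IsHomogeneous.sum _ _ _ fun i _ => by
      rw [MvPolynomial.smul_eq_C_mul]
      exact (MvPolynomial.isHomogeneous_X _ i).C_mul _
  rwa [one_mul] at this

theorem kamekoP_eq_zero_of_lt {k n : ℕ} {f : P k} (hf : f.IsHomogeneous n) (hn : n < k) :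
    kamekoP k f = 0 := by
  rw [eq_sum_monomial f, map_sum]
  refine Finset.sum_eq_zero fun j hj => ?_
  rw [kamekoP_monomial, if_neg]
  intro hodd
  have hdeg := degree_eq_of_mem_support hf hj
  rw [Finsupp.degree_eq_sum] at hdeg
  have : ∑ _t : Fin k, 1 ≤ ∑ t, j t := Finset.sum_le_sum fun t _ => (hodd t).pos
  simp only [Finset.sum_const, Finset.card_univ, Fintype.card_fin, smul_eq_mul, mul_one] at this
  omega

/-- On a monomial `q² ∏_E x_i`, substitution preserves the square and `kamekoP` pulls out its root.
If `E` is not everything, what remains has degree below `k`, too small for an all-odd monomial, and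
both sides vanish. Invertibility of `g` is not needed. -/
theorem kamekoP_substP_eq_mul (k : ℕ) (g : Matrix (Fin k) (Fin k) (ZMod 2)) (f : P k) :
    kamekoP k (substP k g f) =
      kamekoP k (substP k g (∏ i, MvPolynomial.X i)) * substP k g (kamekoP k f) := by
  rw [eq_sum_monomial f]
  simp only [map_sum, Finset.mul_sum]
  refine Finset.sum_congr rfl fun j _ => ?_
  obtain ⟨E, q, -, -, e⟩ := exists_monomial_eq_prod_X_mul_sq j
  rw [e, mul_comm (∏ i ∈ E, _), map_mul, map_pow, kamekoP_sq_mul, kamekoP_sq_mul, kamekoP_prod_X]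
  split_ifs with hE
  · rw [hE, mul_one, mul_comm]
  · rw [mul_zero, map_zero, mul_zero,
      kamekoP_eq_zero_of_lt (substP_isHomogeneous g (prod_X_isHomogeneous E)), mul_zero]
    exact (Finset.card_lt_iff_ne_univ E).2 hE |>.trans_eq (Fintype.card_fin k)

/-- By degree this is a constant: the permanent of `g`, which is its determinant over `𝔽₂`.
Determinants are avoided: if it were zero, `kamekoP_substP_eq_mul` for `g⁻¹`, applied to the
substituted product, would give `1 = 0`. -/
theorem kamekoP_substP_prod_X (k : ℕ) (g : GL (Fin k) (ZMod 2)) :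
    kamekoP k (substP k g (∏ i, MvPolynomial.X i)) = 1 := by
  have hhom : (kamekoP k (substP k g (∏ i, MvPolynomial.X i))).IsHomogeneous 0 := by
    refine kamekoP_isHomogeneous ?_
    rw [Nat.mul_zero, Nat.zero_add]
    have := substP_isHomogeneous g.1 (prod_X_isHomogeneous (Finset.univ : Finset (Fin k)))
    rwa [Finset.card_univ, Fintype.card_fin] at this
  have hinv : substP k (g⁻¹ : GL (Fin k) (ZMod 2)).1 (substP k g (∏ i, MvPolynomial.X i)) =
      ∏ i, MvPolynomial.X i := by
    have := LinearMap.congr_fun ((glRep k).map_mul g⁻¹ g) (∏ i, MvPolynomial.X i)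
    rw [inv_mul_cancel, map_one] at this
    exact this.symm
  have hne : kamekoP k (substP k g (∏ i, MvPolynomial.X i)) ≠ 0 := by
    intro h0
    have := kamekoP_substP_eq_mul k (g⁻¹ : GL (Fin k) (ZMod 2)).1
      (substP k g (∏ i, MvPolynomial.X i))
    rw [h0, hinv, map_zero, mul_zero, kamekoP_prod_X, if_pos rfl] at this
    exact one_ne_zero this
  have hC := MvPolynomial.totalDegree_eq_zero_iff_eq_C.1 (Nat.le_zero.1 hhom.totalDegree_le)
  have hne' : MvPolynomial.coeff 0 (kamekoP k (substP k g (∏ i, MvPolynomial.X i))) ≠ 0 :=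
    fun h => hne (by rw [hC, h, map_zero])
  rw [hC, zmod_two_eq_one hne', map_one]

theorem kamekoP_substP (k : ℕ) (g : GL (Fin k) (ZMod 2)) (f : P k) :
    kamekoP k (substP k g f) = substP k g (kamekoP k f) := by
  rw [kamekoP_substP_eq_mul, kamekoP_substP_prod_X, one_mul]

theorem kamekoSq_indecRep (k : ℕ) (g : GL (Fin k) (ZMod 2)) (v : Indec k) :
    kamekoSq k (indecRep k g v) = indecRep k g (kamekoSq k v) := by
  obtain ⟨f, rfl⟩ := (hit k).mkQ_surjective v
  exact congrArg (hit k).mkQ (kamekoP_substP k g f)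

theorem kamekoSq_pow_indecRep (k s : ℕ) (g : GL (Fin k) (ZMod 2)) (v : Indec k) :
    (kamekoSq k ^ s) (indecRep k g v) = indecRep k g ((kamekoSq k ^ s) v) := by
  induction s with
  | zero => rfl
  | succ s ih => rw [pow_succ', Module.End.mul_apply, ih, kamekoSq_indecRep, Module.End.mul_apply]

/-! ### The degrees `12 · 2^s - 4` -/

theorem two_pow_cases (a : ℕ) :
    2 ^ a = 1 ∨ 2 ^ a = 2 ∨ 2 ^ a = 4 ∨ ∃ x, 1 ≤ x ∧ 2 ^ a = 8 * x := by
  match a with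
  | 0 => simp
  | 1 => simp
  | 2 => simp
  | a + 3 => exact .inr (.inr (.inr ⟨2 ^ a, Nat.one_le_two_pow, by ring⟩))

/-- Powers of 2 are 1, 2, 4 or 0 modulo 8, so the left side is divisible by 8 only for the powers 1,
2, 4 in some order. It is then 8, which is less than 24. -/
theorem two_pow_add_ne (a b c : ℕ) {y : ℕ} (hy : 1 ≤ y) : 2 ^ a + 2 ^ b + 2 ^ c + 1 ≠ 24 * y := by
  rcases two_pow_cases a with h | h | h | ⟨x, hx, h⟩ <;>
  rcases two_pow_cases b with h' | h' | h' | ⟨x', hx', h'⟩ <;>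
  rcases two_pow_cases c with h'' | h'' | h'' | ⟨x'', hx'', h''⟩ <;> omega

theorem notShortSum_four (s : ℕ) : NotShortSum 4 (12 * 2 ^ (s + 1) - 4) := by
  rintro a ⟨i, hi⟩ h
  rw [Fin.sum_univ_four] at h
  have h0 := Nat.one_le_two_pow (n := a 0)
  have h1 := Nat.one_le_two_pow (n := a 1)
  have h2 := Nat.one_le_two_pow (n := a 2)
  have h3 := Nat.one_le_two_pow (n := a 3)
  have hs := Nat.one_le_two_pow (n := s)
  have hi' : 2 ^ a i = 1 := by rw [hi, pow_zero]
  rw [pow_succ] at h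
  -- The summand with zero exponent drops out; the other three would give `2^a + 2^b + 2^c + 1 = 24
  -- * 2^s`.
  fin_cases i <;> simp only [Fin.zero_eta, Fin.mk_one, Fin.reduceFinMk] at hi'
  · exact two_pow_add_ne (a 1) (a 2) (a 3) hs (by omega)
  · exact two_pow_add_ne (a 0) (a 2) (a 3) hs (by omega)
  · exact two_pow_add_ne (a 0) (a 1) (a 3) hs (by omega)
  · exact two_pow_add_ne (a 0) (a 1) (a 2) hs (by omega)

/-- Only the source degree of each step must fail to be a short sum. The final target 8 = 7 + 1 is
one, so the descent stops there. -/
theorem kamekoSq_pow_bijOn (s : ℕ) :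
    Set.BijOn (kamekoSq 4 ^ s) (indecDegree 4 (12 * 2 ^ s - 4)) (indecDegree 4 8) := by
  induction s with
  | zero => exact Set.bijOn_id _
  | succ s ih =>
    have hd := notShortSum_four s
    have e : 12 * 2 ^ (s + 1) - 4 = 2 * (12 * 2 ^ s - 4) + 4 := by
      have := Nat.one_le_two_pow (n := s)
      rw [pow_succ]
      omega
    rw [e] at hd ⊢
    exact ih.comp (kamekoSq_bijOn hd)

end

end HitProblem

theorem lemma2p4 (s : ℕ) (hs : 1 ≤ s) :
    ∃ e : (HitProblem.indecDegreeRep 4 (12 * 2 ^ s - 4)).Equiv (HitProblem.indecDegreeRep 4 8),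
      ∀ v : HitProblem.indecDegree 4 (12 * 2 ^ s - 4),
        ((e v : HitProblem.indecDegree 4 8) : HitProblem.Indec 4) =
          (HitProblem.kamekoSq 4 ^ s) (v : HitProblem.Indec 4) := by
  have hbij := HitProblem.kamekoSq_pow_bijOn s
  let φ : HitProblem.indecDegree 4 (12 * 2 ^ s - 4) →ₗ[ZMod 2] HitProblem.indecDegree 4 8 :=
    (HitProblem.kamekoSq 4 ^ s).restrict hbij.mapsTo
  have hφ : Function.Bijective φ := hbij.bijective
  refine ⟨Representation.Equiv.mk (LinearEquiv.ofBijective φ hφ) fun g => ?_, fun v => rfl⟩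
  -- Equivariance is checked in the whole of `Indec 4`, where the iterate commutes with the group.
  refine LinearMap.ext fun v => Subtype.ext ?_
  exact HitProblem.kamekoSq_pow_indecRep 4 s g v
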